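/- \textbf{Proposition (Markov Process).} Let $\mathcal T=(\mathcal V,\mathcal E,\ell)$ be a finite tree with edge lengths $\ell(e)>0$, regarded also as the continuous (metric) tree obtained by replacing each edge $e$ by a segment of length $\ell(e)$. Let $d\ge 0$, let $\mathcal C_{\mathcal T}=C(\mathcal T,\mathbb R^d)$ with its Borel $\sigma$-algebra, let $X$ be the canonical process, and write $\mathbb P_p$ for the law of $X_p$ under a positive measure $\mathbb P$ on $\mathcal C_{\mathcal T}$, $p\in\mathcal T$. A split of $\mathcal T$ at a point $p$ is a pair of closed sets $A,B\subset\mathcal T$ with $A\cup B=\mathcal T$, $A\cap B=\{p\}$, $A\ne\{p\}\ne B$; here $p$ may lie inside an edge or be a vertex. A positive (possibly unbounded) measure $\mathbb P$ on $\mathcal C_{\mathcal T}$ is called Markov if $\mathbb P_q$ is $\sigma$-finite for some $q\in\mathcal T$ and, for every split $(A,B)$ at every $p$, the regular conditional laws given $X_p$ exist and satisfy $$\mathbb P(X_{|A}\in\cdot\,,\,X_{|B}\in\cdot\cdot\mid X_p)=\mathbb P(X_{|A}\in\cdot\mid X_p)\,\mathbb P(X_{|B}\in\cdot\cdot\mid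 X_p)\qquad \mathbb P_p\text{-a.e.}$$ Let $\mathbb Q$ be a Markov positive measure on $\mathcal C_{\mathcal T}$, let $\mathcal S\subset\mathcal V$ and let $\mu_i$, $i\in\mathcal S$, be probability measures on $\mathbb R^d$. For a probability measure $\mathbb P$ on $\mathcal C_{\mathcal T}$ put $\mathrm{KL}(\mathbb P\Vert\mathbb Q)=\int\log\frac{d\mathbb P}{d\mathbb Q}\,d\mathbb P\in(-\infty,\infty]$ if $\mathbb P\ll\mathbb Q$ and the negative part of $\log\frac{d\mathbb P}{d\mathbb Q}$ is $\mathbb P$-integrable, and $\mathrm{KL}(\mathbb P\Vert\mathbb Q)=\infty$ otherwise. Let $\mathbb P^{SB}$ be a solution of the dynamic tree-structured Schr\"odinger bridge problem, that is, a minimiser of $\mathrm{KL}(\cdot\Vert\mathbb Q)$, with finite minimal value, over the probability measures $\mathbb P$ on $\mathcal C_{\mathcal T}$ with $\mathbb P_i=\mu_i$ for all $i\in\mathcal S$. Then $\mathbb P^{SB}$ is Markov. -/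

import Mathlib

open MeasureTheory ProbabilityTheory Set
open scoped ENNReal

noncomputable section

/-- A tree with vertex set `V` and an edge-length function `ℓ : E → (0, ∞)`. -/
structure LengthTree (V : Type*) where
  graph : SimpleGraph V
  isTree : graph.IsTree
  length : graph.edgeSet → ℝ
  length_pos : ∀ e, 0 < length e

namespace LengthTree

variable {V : Type*} (T : LengthTree V)

/-- The length of the edge underlying an oriented edge. -/
def dartLength (e : T.graph.Dart) : ℝ := T.length ⟨e.edge, e.edge_mem⟩

/-- The pieces that are glued: the vertices, and for every oriented edge `e = (u, v)` the
segment `[0, ℓ(e)]`. -/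
abbrev Piece : Type _ := V ⊕ (Σ e : T.graph.Dart, Icc (0 : ℝ) (T.dartLength e))

/-- The gluing: for `e = (u, v)`, the start of the segment of `e` is `u`, its end is `v`, and
time `t` on `(u, v)` is the same point as time `ℓ(e) - t` on `(v, u)`. -/
inductive Glue : T.Piece → T.Piece → Prop
  | start (e : T.graph.Dart) (t : Icc (0 : ℝ) (T.dartLength e)) (ht : (t : ℝ) = 0) :
      Glue (Sum.inr ⟨e, t⟩) (Sum.inl e.fst)
  | finish (e : T.graph.Dart) (t : Icc (0 : ℝ) (T.dartLength e))
      (ht : (t : ℝ) = T.dartLength e) :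
      Glue (Sum.inr ⟨e, t⟩) (Sum.inl e.snd)
  | reverse (e : T.graph.Dart) (t : Icc (0 : ℝ) (T.dartLength e))
      (s : Icc (0 : ℝ) (T.dartLength e.symm)) (hs : (s : ℝ) = T.dartLength e - t) :
      Glue (Sum.inr ⟨e, t⟩) (Sum.inr ⟨e.symm, s⟩)

/-- The continuous tree: segments of length `ℓ(e)` joined according to the graph structure. -/
def Point : Type _ := Quot T.Glue

/-- A vertex, as a point of the continuous tree. -/
def vertex (v : V) : T.Point := Quot.mk _ (Sum.inl v)

/-- The point at time `t ∈ [0, ℓ(e)]` on the oriented edge `e`. -/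
def onEdge (e : T.graph.Dart) (t : Icc (0 : ℝ) (T.dartLength e)) : T.Point :=
  Quot.mk _ (Sum.inr ⟨e, t⟩)

/-- A set of points is open iff its trace on every segment `[0, ℓ(e)]` is open. For a finite
tree this is the topology of the arc-length metric. -/
instance : TopologicalSpace T.Point :=
  ⨆ e : T.graph.Dart, TopologicalSpace.coinduced (T.onEdge e) inferInstance

/-- `A` and `B` are the two parts of a splitting of the continuous tree at the point `p`: closed
sets that cover the tree, meet exactly at `p`, and are both larger than `{p}`. At a point inside
an edge the two parts are unique up to order; at a vertex, the branches issuing from it are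
distributed arbitrarily among the two parts. -/
structure IsSplit (p : T.Point) (A B : Set T.Point) : Prop where
  isClosed_left : IsClosed A
  isClosed_right : IsClosed B
  union_eq : A ∪ B = univ
  inter_eq : A ∩ B = {p}
  left_ne : A ≠ {p}
  right_ne : B ≠ {p}

end LengthTree

/-- Spaces of continuous paths carry the Borel σ-algebra of the topology of uniform convergence
on compact sets. -/
instance ContinuousMap.measurableSpaceBorel {X Y : Type*} [TopologicalSpace X]
    [TopologicalSpace Y] : MeasurableSpace C(X, Y) := borel _

instance ContinuousMap.borelSpaceBorel {X Y : Type*} [TopologicalSpace X]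
    [TopologicalSpace Y] : BorelSpace C(X, Y) := ⟨rfl⟩

/-- The Markov kernel `K` is a regular conditional law of `Y` given `X` under the (possibly
unbounded) measure `P`: `P(X ∈ dx, Y ∈ dy) = P(X ∈ dx) K(x, dy)`. -/
def IsCondLaw {Ω E F : Type*} [MeasurableSpace Ω] [MeasurableSpace E] [MeasurableSpace F]
    (P : Measure Ω) (X : Ω → E) (Y : Ω → F) (K : Kernel E F) : Prop :=
  IsMarkovKernel K ∧ P.map (fun ω => (X ω, Y ω)) = (P.map X) ⊗ₘ K

namespace LengthTree

variable {V : Type*} (T : LengthTree V) (d : ℕ)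

/-- `C(T, ℝᵈ)`, the continuous paths indexed by the continuous tree. -/
abbrev PathSpace : Type _ := C(T.Point, EuclideanSpace ℝ (Fin d))

variable {T d}

/-- The marginal of a path measure at a point of the tree. -/
def marginal (P : Measure (T.PathSpace d)) (p : T.Point) :
    Measure (EuclideanSpace ℝ (Fin d)) :=
  P.map (fun ω => ω p)

/-- A positive path measure on the tree is Markov if some time-marginal is σ-finite and, for
every splitting of the tree at a point `p` into two parts, the restrictions of the process to
the two parts are conditionally independent given its value at `p`: the conditional law of the
pair is the product of the conditional laws. -/
structure IsMarkov (P : Measure (T.PathSpace d)) : Prop where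
  exists_sigmaFinite : ∃ p : T.Point, SigmaFinite (marginal P p)
  condIndep : ∀ (p : T.Point) (A B : Set T.Point), T.IsSplit p A B →
    ∃ (K : Kernel (EuclideanSpace ℝ (Fin d)) C(A, EuclideanSpace ℝ (Fin d)))
      (L : Kernel (EuclideanSpace ℝ (Fin d)) C(B, EuclideanSpace ℝ (Fin d))),
      IsCondLaw P (fun ω => ω p) (fun ω => ω.restrict A) K ∧
      IsCondLaw P (fun ω => ω p) (fun ω => ω.restrict B) L ∧
      IsCondLaw P (fun ω => ω p) (fun ω => (ω.restrict A, ω.restrict B)) (K ×ₖ L)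

end LengthTree

open Classical in
/-- Relative entropy `KL(P ‖ Q) = ∫ log (dP/dQ) dP ∈ (-∞, ∞]` of a probability measure `P` with
respect to a σ-finite, possibly unbounded, positive measure `Q`. It is defined when the negative
part of `log (dP/dQ)` is `P`-integrable (which is automatic when `Q` is finite) and is `∞` when
`P` is not absolutely continuous with respect to `Q`. Outside the domain of definition it gets
the value `∞`, so that minimising it means minimising over its domain. -/
def relEntropy {Ω : Type*} [MeasurableSpace Ω] (P Q : Measure Ω) : EReal :=
  if P ≪ Q ∧ ∫⁻ ω, ENNReal.ofReal (-llr P Q ω) ∂P ≠ ∞ then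
    ((∫⁻ ω, ENNReal.ofReal (llr P Q ω) ∂P : ℝ≥0∞) : EReal)
      - ((∫⁻ ω, ENNReal.ofReal (-llr P Q ω) ∂P : ℝ≥0∞) : EReal)
  else ⊤

namespace LengthTree

variable {V : Type*} {T : LengthTree V} {d : ℕ}

/-- The constraints of the tree-structured Schrödinger bridge problem: `P` is a probability
measure on paths whose marginal at every observed vertex `i ∈ S` is `μ i`. -/
def IsAdmissible (S : Set V) (μ : S → Measure (EuclideanSpace ℝ (Fin d)))
    (P : Measure (T.PathSpace d)) : Prop :=
  IsProbabilityMeasure P ∧ ∀ i : S, marginal P (T.vertex i) = μ i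

/-- `P` solves the dynamic tree-structured Schrödinger bridge problem: it is admissible, has
finite relative entropy with respect to `Q`, and minimises it among the admissible measures. -/
structure IsTreeSBSolution (Q : Measure (T.PathSpace d)) (S : Set V)
    (μ : S → Measure (EuclideanSpace ℝ (Fin d))) (P : Measure (T.PathSpace d)) : Prop where
  admissible : IsAdmissible S μ P
  finite : relEntropy P Q < ⊤
  minimal : ∀ P' : Measure (T.PathSpace d), IsAdmissible S μ P' →
    relEntropy P Q ≤ relEntropy P' Q

end LengthTree

end

/-! Fix a split `(A, B)` at `p` and let `X`, `Y`, `W` be the value at `p` and the restrictions to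
`A` and `B`. Let `P'` keep the law of `X` and both conditional laws under the minimiser `P`, but
glue the two parts independently given `X`. Every vertex lies in `A` or `B`, so `P'` satisfies the
constraints. Since `Q` is Markov, `P'` has a `Q`-density `Z'` of product form, and `log Z'` is a sum
of functions of `(X, Y)`, `(X, W)` and `X`, whose laws `P` and `P'` share. Formally `KL(P‖Q) -
KL(P'‖Q) = ∫ log (Z/Z') dP = KL(P‖P')`, where `Z = dP/dQ`; minimality makes this nonpositive, so `P
= P'`.

As `Q` may have infinite mass, the terms of `log Z'` need not be integrable. The comparison is
therefore made on events `X ∈ C` with `Q(X ∈ C) < ∞`: the competitor equals `P'` there and `P`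
elsewhere, and remains admissible because the event depends on `X` alone. Countably many such events
cover the space, since `Q_p` inherits σ-finiteness from `Q_q`.

The argument is `exists_isCondLaw_of_minimal`, resting on `integrable_log_density_map`,
`withDensity_eq_of_integral_log_le` and `exists_normalized_density`. -/

/-! ### Densities, their logarithms and relative entropy. -/

section Density

variable {Ω F : Type*} [MeasurableSpace Ω] [MeasurableSpace F]

theorem map_withDensity_comp (Q : Measure Ω) {T : Ω → F} (hT : Measurable T) {g : F → ℝ≥0∞}
    (hg : Measurable g) :
    (Q.withDensity (fun ω => g (T ω))).map T = (Q.map T).withDensity g := by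
  ext s hs
  rw [Measure.map_apply hT hs, withDensity_apply _ (hT hs), withDensity_apply _ hs,
    setLIntegral_map hs hg hT]

theorem map_restrict_preimage_withDensity {P Q : Measure Ω} {T : Ω → F} (hT : Measurable T)
    {g : F → ℝ≥0∞} (h : P.map T = (Q.map T).withDensity g) {C : Set F} (hC : MeasurableSet C) :
    (P.restrict (T ⁻¹' C)).map T = ((Q.restrict (T ⁻¹' C)).map T).withDensity g := by
  rw [← Measure.restrict_map hT hC, ← Measure.restrict_map hT hC, h, restrict_withDensity hC]

theorem map_restrict_preimage_congr {P P' : Measure Ω} {T : Ω → F} (hT : Measurable T)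
    (h : P.map T = P'.map T) {C : Set F} (hC : MeasurableSet C) :
    (P.restrict (T ⁻¹' C)).map T = (P'.restrict (T ⁻¹' C)).map T := by
  rw [← Measure.restrict_map hT hC, ← Measure.restrict_map hT hC, h]

/-- A density of a finite measure takes values in `(0, ∞)` almost everywhere. -/
theorem ae_withDensity_ne_zero_ne_top (Q : Measure Ω) {g : Ω → ℝ≥0∞} (hg : Measurable g)
    [IsFiniteMeasure (Q.withDensity g)] : ∀ᵐ ω ∂(Q.withDensity g), g ω ≠ 0 ∧ g ω ≠ ∞ := by
  rw [ae_withDensity_iff hg]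
  have h : ∫⁻ ω, g ω ∂Q ≠ ∞ := by
    have := measure_ne_top (Q.withDensity g) univ
    rwa [withDensity_apply _ MeasurableSet.univ, Measure.restrict_univ] at this
  filter_upwards [ae_lt_top hg h] with ω hω h0 using ⟨h0, hω.ne⟩

theorem ae_comp_ne_zero_ne_top {P Q : Measure Ω} [IsFiniteMeasure P] {T : Ω → F}
    (hT : Measurable T) {g : F → ℝ≥0∞} (hg : Measurable g)
    (h : P.map T = (Q.map T).withDensity g) : ∀ᵐ ω ∂P, g (T ω) ≠ 0 ∧ g (T ω) ≠ ∞ := by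
  have : IsFiniteMeasure ((Q.map T).withDensity g) := by rw [← h]; infer_instance
  have h2 := ae_withDensity_ne_zero_ne_top (Q.map T) hg
  rw [← h] at h2
  exact ae_of_ae_map hT.aemeasurable h2

/-- From `log a ≥ 1 - 1/a` one gets `-a log a ≤ 1 - a`. At `a = ∞` the conventions `∞.toReal = 0`
and `Real.log 0 = 0` make the left side vanish. -/
theorem mul_ofReal_neg_log_le_one (a : ℝ≥0∞) : a * ENNReal.ofReal (-Real.log a.toReal) ≤ 1 := by
  rcases eq_or_ne a ∞ with rfl | ha
  · simp
  rcases eq_or_ne a 0 with rfl | h0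
  · simp
  have hpos : 0 < a.toReal := ENNReal.toReal_pos h0 ha
  conv_lhs => rw [← ENNReal.ofReal_toReal ha]
  rw [ENNReal.toReal_ofReal hpos.le, ← ENNReal.ofReal_mul hpos.le]
  refine ENNReal.ofReal_le_one.2 ?_
  have h1 := Real.one_sub_inv_le_log_of_pos hpos
  have h2 : a.toReal * a.toReal⁻¹ = 1 := mul_inv_cancel₀ hpos.ne'
  nlinarith

/-- With respect to a finite measure, the negative part of the log-density is integrable. -/
theorem lintegral_neg_log_density_le (Q : Measure Ω) {g : Ω → ℝ≥0∞} (hg : Measurable g) :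
    ∫⁻ ω, ENNReal.ofReal (-Real.log (g ω).toReal) ∂(Q.withDensity g) ≤ Q univ := by
  rw [lintegral_withDensity_eq_lintegral_mul _ hg (by fun_prop)]
  calc _ ≤ ∫⁻ _, 1 ∂Q := lintegral_mono fun ω => mul_ofReal_neg_log_le_one (g ω)
    _ = Q univ := by simp

/-- Change of the reference measure in a density. -/
theorem withDensity_eq_withDensity_div (Q : Measure Ω) {f g : Ω → ℝ≥0∞} (hf : Measurable f)
    (hg : Measurable g) (h : ∀ᵐ ω ∂(Q.withDensity f), g ω ≠ 0 ∧ g ω ≠ ∞) :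
    Q.withDensity f = (Q.withDensity g).withDensity (fun ω => f ω / g ω) := by
  rw [show (fun ω => f ω / g ω) = f / g from rfl, ← withDensity_mul _ hg (hf.div hg)]
  refine withDensity_congr_ae ?_
  rw [ae_withDensity_iff hf] at h
  filter_upwards [h] with ω hω
  rcases eq_or_ne (f ω) 0 with h0 | h0
  · simp [h0]
  · exact (ENNReal.mul_div_cancel (hω h0).1 (hω h0).2).symm

theorem log_toReal_div {a b : ℝ≥0∞} (ha : a ≠ 0 ∧ a ≠ ∞) (hb : b ≠ 0 ∧ b ≠ ∞) :
    Real.log (a / b).toReal = Real.log a.toReal - Real.log b.toReal := by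
  rw [ENNReal.toReal_div, Real.log_div (ENNReal.toReal_ne_zero.2 ha) (ENNReal.toReal_ne_zero.2 hb)]

theorem log_toReal_mul {a b : ℝ≥0∞} (ha : a ≠ 0 ∧ a ≠ ∞) (hb : b ≠ 0 ∧ b ≠ ∞) :
    Real.log (a * b).toReal = Real.log a.toReal + Real.log b.toReal := by
  rw [ENNReal.toReal_mul, Real.log_mul (ENNReal.toReal_ne_zero.2 ha) (ENNReal.toReal_ne_zero.2 hb)]

theorem integrable_of_lintegral_ofReal {P : Measure Ω} {f : Ω → ℝ} (hf : Measurable f)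
    (h1 : ∫⁻ ω, ENNReal.ofReal (f ω) ∂P ≠ ∞) (h2 : ∫⁻ ω, ENNReal.ofReal (-f ω) ∂P ≠ ∞) :
    Integrable f P := by
  refine ⟨hf.aestronglyMeasurable, ?_⟩
  rw [hasFiniteIntegral_iff_norm]
  refine lt_of_le_of_lt (lintegral_mono (g := fun ω => ENNReal.ofReal (f ω)
    + ENNReal.ofReal (-f ω)) fun ω => ?_) ?_
  · rw [Real.norm_eq_abs]
    rcases abs_choice (f ω) with h | h <;> rw [h]
    · exact le_self_add
    · exact le_add_self
  · rw [lintegral_add_left (by fun_prop)]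
    exact ENNReal.add_lt_top.2 ⟨h1.lt_top, h2.lt_top⟩

/-- If the log-density of `P` with respect to a finite measure is integrable, so is the
log-density of the image of `P` under any map. -/
theorem integrable_log_density_map {Q : Measure Ω} [IsFiniteMeasure Q] {Z : Ω → ℝ≥0∞}
    (hZ : Measurable Z) [IsFiniteMeasure (Q.withDensity Z)]
    (hint : Integrable (fun ω => Real.log (Z ω).toReal) (Q.withDensity Z))
    {T : Ω → F} (hT : Measurable T) {g : F → ℝ≥0∞} (hg : Measurable g)
    (h : (Q.withDensity Z).map T = (Q.map T).withDensity g) :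
    Integrable (fun ω => Real.log (g (T ω)).toReal) (Q.withDensity Z) := by
  have hgT : Measurable fun ω => g (T ω) := hg.comp hT
  have hg0 := ae_comp_ne_zero_ne_top hT hg h
  refine integrable_of_lintegral_ofReal (by fun_prop) ?_ ?_
  -- Positive part: `log g(T) = log Z - log (Z / g(T))`, and `Z / g(T)` is a density with respect to
  -- the finite measure `g(T) Q`, so the negative part of its logarithm is integrable.
  · have hdiv := withDensity_eq_withDensity_div Q hZ hgT hg0
    have hM : (Q.withDensity fun ω => g (T ω)) univ ≠ ∞ := by
      have h1 : ((Q.withDensity fun ω => g (T ω)).map T) univ = (Q.withDensity Z).map T univ := by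
        rw [map_withDensity_comp Q hT hg, h]
      rw [Measure.map_apply hT .univ, Measure.map_apply hT .univ, preimage_univ] at h1
      rw [h1]
      exact measure_ne_top _ _
    have hneg := lintegral_neg_log_density_le (Q.withDensity fun ω => g (T ω))
      (g := fun ω => Z ω / g (T ω)) (hZ.div hgT)
    rw [← hdiv] at hneg
    have hpos : ∫⁻ ω, ENNReal.ofReal (Real.log (Z ω).toReal) ∂(Q.withDensity Z) ≠ ∞ := by
      refine ne_of_lt (lt_of_le_of_lt (lintegral_mono fun ω => ?_)
        (hasFiniteIntegral_iff_norm _ |>.1 hint.2))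
      exact ENNReal.ofReal_le_ofReal (Real.le_norm_self _)
    refine ne_of_lt (lt_of_le_of_lt (b := ∫⁻ ω, (ENNReal.ofReal (Real.log (Z ω).toReal)
      + ENNReal.ofReal (-Real.log (Z ω / g (T ω)).toReal)) ∂(Q.withDensity Z))
      (lintegral_mono_ae ?_) ?_)
    · filter_upwards [hg0, ae_withDensity_ne_zero_ne_top Q hZ] with ω h1 h2
      rw [log_toReal_div h2 h1]
      refine le_trans (ENNReal.ofReal_le_ofReal ?_) ENNReal.ofReal_add_le
      linarith
    · rw [lintegral_add_left (by fun_prop)]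
      exact ENNReal.add_lt_top.2 ⟨hpos.lt_top, lt_of_le_of_lt hneg hM.lt_top⟩
  -- Negative part: bounded on the image space by the mass of `Q.map T`.
  · have h1 := lintegral_neg_log_density_le (Q.map T) hg
    rw [← h, lintegral_map (by fun_prop) hT] at h1
    exact ne_of_lt (lt_of_le_of_lt h1 (measure_lt_top _ _))

/-- Equality in Gibbs' inequality, in terms of densities. -/
theorem withDensity_eq_of_integral_log_le {Q : Measure Ω} {f g : Ω → ℝ≥0∞}
    (hf : Measurable f) (hg : Measurable g) [IsFiniteMeasure (Q.withDensity f)]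
    [IsFiniteMeasure (Q.withDensity g)] (hmass : Q.withDensity f univ = Q.withDensity g univ)
    (h0 : ∀ᵐ ω ∂(Q.withDensity f), g ω ≠ 0 ∧ g ω ≠ ∞)
    (hfint : Integrable (fun ω => Real.log (f ω).toReal) (Q.withDensity f))
    (hgint : Integrable (fun ω => Real.log (g ω).toReal) (Q.withDensity f))
    (hle : ∫ ω, Real.log (f ω).toReal ∂(Q.withDensity f)
      ≤ ∫ ω, Real.log (g ω).toReal ∂(Q.withDensity f)) :
    Q.withDensity f = Q.withDensity g := by
  have hdiv := withDensity_eq_withDensity_div Q hf hg h0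
  have hac : Q.withDensity f ≪ Q.withDensity g := by
    rw [hdiv]; exact withDensity_absolutelyContinuous _ _
  have hllr : llr (Q.withDensity f) (Q.withDensity g) =ᵐ[Q.withDensity f]
      fun ω => Real.log (f ω).toReal - Real.log (g ω).toReal := by
    have h1 : (Q.withDensity f).rnDeriv (Q.withDensity g) =ᵐ[Q.withDensity g]
        fun ω => f ω / g ω := by
      conv_lhs => rw [hdiv]
      exact Measure.rnDeriv_withDensity _ (hf.div hg)
    filter_upwards [hac.ae_le h1, h0, ae_withDensity_ne_zero_ne_top Q hf] with ω h1 h2 h3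
    rw [llr, h1, log_toReal_div h3 h2]
  -- `klDiv` contains the difference of the total masses, which `hmass` cancels.
  rw [← InformationTheory.klDiv_eq_zero_iff, InformationTheory.klDiv_of_ac_of_integrable hac
    ((integrable_congr hllr).2 (hfint.sub hgint)), integral_congr_ae hllr,
    integral_sub hfint hgint, measureReal_def, measureReal_def, hmass]
  exact ENNReal.ofReal_eq_zero.2 (by linarith)

/-- Finiteness excludes the default value `⊤`, and also an infinite positive part, which minus a
finite negative part would again be `⊤`. -/
theorem absolutelyContinuous_and_integrable_of_relEntropy_lt_top {P Q : Measure Ω}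
    (h : relEntropy P Q < ⊤) : P ≪ Q ∧ Integrable (llr P Q) P := by
  classical
  unfold relEntropy at h
  split_ifs at h with h1
  · refine ⟨h1.1, integrable_of_lintegral_ofReal (measurable_llr P Q) (fun h2 => ?_) h1.2⟩
    rw [h2] at h
    lift (∫⁻ ω, ENNReal.ofReal (-llr P Q ω) ∂P) to NNReal using h1.2 with a
    exact absurd h (by simp)
  · exact absurd h (lt_irrefl _)

theorem relEntropy_eq_integral {P Q : Measure Ω} (hac : P ≪ Q) (hint : Integrable (llr P Q) P) :
    relEntropy P Q = ((∫ ω, llr P Q ω ∂P : ℝ) : EReal) := by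
  classical
  have key : ∀ f : Ω → ℝ, Integrable f P → ∫⁻ ω, ENNReal.ofReal (f ω) ∂P ≠ ∞ := fun f hf =>
    ne_of_lt (lt_of_le_of_lt (lintegral_mono fun ω =>
      ENNReal.ofReal_le_ofReal (Real.le_norm_self _)) (hasFiniteIntegral_iff_norm _ |>.1 hf.2))
  have h1 := key _ hint
  have h2 := key _ hint.neg
  simp only [Pi.neg_apply] at h2
  rw [relEntropy, if_pos ⟨hac, h2⟩, integral_eq_lintegral_pos_part_sub_lintegral_neg_part hint,
    EReal.coe_sub]
  rw [EReal.coe_ennreal_toReal h1, EReal.coe_ennreal_toReal h2]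

theorem relEntropy_withDensity {Q : Measure Ω} [SigmaFinite Q] {f : Ω → ℝ≥0∞}
    (hf : Measurable f)
    (hint : Integrable (fun ω => Real.log (f ω).toReal) (Q.withDensity f)) :
    relEntropy (Q.withDensity f) Q
      = ((∫ ω, Real.log (f ω).toReal ∂(Q.withDensity f) : ℝ) : EReal) := by
  have hac := withDensity_absolutelyContinuous Q f
  have hllr : llr (Q.withDensity f) Q =ᵐ[Q.withDensity f] fun ω => Real.log (f ω).toReal := by
    filter_upwards [hac.ae_le (Measure.rnDeriv_withDensity Q hf)] with ω hω
    rw [llr, hω]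
  rw [relEntropy_eq_integral hac ((integrable_congr hllr).2 hint), integral_congr_ae hllr]

end Density

/-! ### Disintegrations and kernels with densities. -/

section Kernel

variable {E F G : Type*} [MeasurableSpace E] [MeasurableSpace F] [MeasurableSpace G]

/-- Integrating a strictly positive integrable function over the fibres gives `f > 0` with `f μ`
finite, and `μ` is recovered from `f μ` with the finite density `1/f`. -/
theorem sigmaFinite_of_compProd (μ : Measure E) [SFinite μ] (κ : Kernel E F) [IsMarkovKernel κ]
    [SigmaFinite (μ ⊗ₘ κ)] : SigmaFinite μ := by
  obtain ⟨g, hpos, hg, hlt⟩ := exists_pos_lintegral_lt_of_sigmaFinite (μ ⊗ₘ κ) one_ne_zero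
  have hg' : Measurable fun p => (g p : ℝ≥0∞) := hg.coe_nnreal_ennreal
  set f : E → ℝ≥0∞ := fun x => ∫⁻ y, g (x, y) ∂(κ x) with hf
  have hfm : Measurable f := hg'.lintegral_kernel_prod_right'
  rw [Measure.lintegral_compProd hg'] at hlt
  have hf0 : ∀ x, f x ≠ 0 := fun x h0 => by
    replace h0 : (fun y => (g (x, y) : ℝ≥0∞)) =ᵐ[κ x] 0 :=
      (lintegral_eq_zero_iff (hg'.comp measurable_prodMk_left)).1 h0
    have : ∀ᵐ y ∂(κ x), False := h0.mono fun y hy => by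
      simpa using (hpos (x, y)).ne' (by simpa using hy)
    simp at this
    exact IsProbabilityMeasure.ne_zero (κ x) this
  have hftop : ∀ᵐ x ∂μ, f x ≠ ∞ := (ae_lt_top hfm (hlt.trans ENNReal.one_lt_top).ne).mono
    fun x hx => hx.ne
  have : IsFiniteMeasure (μ.withDensity f) :=
    isFiniteMeasure_withDensity (hlt.trans ENNReal.one_lt_top).ne
  rw [← withDensity_inv_same hfm (ae_of_all _ hf0) hftop]
  exact SigmaFinite.withDensity_of_ne_top' fun x => by simp [hf0 x]

theorem isMarkovKernel_withDensity (κ : Kernel E F) [IsSFiniteKernel κ] {k : E × F → ℝ≥0∞}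
    (hk : Measurable k) (h1 : ∀ x, ∫⁻ y, k (x, y) ∂(κ x) = 1) :
    IsMarkovKernel (κ.withDensity fun x y => k (x, y)) := by
  refine ⟨fun x => ⟨?_⟩⟩
  have hk' : Measurable (Function.uncurry fun x y => k (x, y)) := hk
  rw [Kernel.withDensity_apply' κ hk', Measure.restrict_univ, h1]

theorem withDensity_compProd_withDensity (μ : Measure E) [SFinite μ] (κ : Kernel E F)
    [IsSFiniteKernel κ] {h : E → ℝ≥0∞} (hh : Measurable h) {k : E × F → ℝ≥0∞} (hk : Measurable k)
    [SFinite (μ.withDensity h)] [IsSFiniteKernel (κ.withDensity fun x y => k (x, y))] :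
    (μ.withDensity h) ⊗ₘ (κ.withDensity fun x y => k (x, y))
      = (μ ⊗ₘ κ).withDensity (fun p => h p.1 * k p) := by
  have hk' : Measurable (Function.uncurry fun x y => k (x, y)) := hk
  rw [Measure.compProd_withDensity hk']
  have h1 : (μ.withDensity h) ⊗ₘ κ = (μ ⊗ₘ κ).withDensity (fun p => h p.1) := by
    ext s hs
    rw [Measure.compProd_apply hs, withDensity_apply _ hs, ← lintegral_indicator hs,
      Measure.lintegral_compProd (by fun_prop (disch := exact hs)),
      lintegral_withDensity_eq_lintegral_mul _ hh (Kernel.measurable_kernel_prodMk_left hs)]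
    refine lintegral_congr fun x => ?_
    rw [Pi.mul_apply, ← lintegral_indicator_one (measurable_prodMk_left hs),
      ← lintegral_const_mul _ (measurable_one.indicator (measurable_prodMk_left hs))]
    refine lintegral_congr fun y => ?_
    by_cases hy : (x, y) ∈ s <;> simp [indicator, hy]
  rw [h1]
  exact (withDensity_mul _ (hh.comp measurable_fst) hk).symm

theorem prod_withDensity_kernel (κ : Kernel E F) (η : Kernel E G) [IsMarkovKernel κ]
    [IsMarkovKernel η] {k : E × F → ℝ≥0∞} {l : E × G → ℝ≥0∞} (hk : Measurable k)
    (hl : Measurable l) [IsMarkovKernel (κ.withDensity fun x y => k (x, y))]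
    [IsMarkovKernel (η.withDensity fun x z => l (x, z))] :
    (κ.withDensity fun x y => k (x, y)) ×ₖ (η.withDensity fun x z => l (x, z))
      = (κ ×ₖ η).withDensity fun x q => k (x, q.1) * l (x, q.2) := by
  ext x : 1
  have hkl : Measurable (Function.uncurry fun (x : E) (q : F × G) => k (x, q.1) * l (x, q.2)) := by
    simp only [Function.uncurry_def]; fun_prop
  have hk' : Measurable (Function.uncurry fun x y => k (x, y)) := hk
  have hl' : Measurable (Function.uncurry fun x z => l (x, z)) := hl
  have hkx : Measurable fun y => k (x, y) := by fun_prop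
  have hlx : Measurable fun z => l (x, z) := by fun_prop
  have i1 : IsProbabilityMeasure ((κ x).withDensity fun y => k (x, y)) := by
    rw [← Kernel.withDensity_apply κ hk']; infer_instance
  have i2 : IsProbabilityMeasure ((η x).withDensity fun z => l (x, z)) := by
    rw [← Kernel.withDensity_apply η hl']; infer_instance
  rw [Kernel.prod_apply, Kernel.withDensity_apply _ hkl, Kernel.prod_apply,
    Kernel.withDensity_apply κ hk', Kernel.withDensity_apply η hl', prod_withDensity hkx hlx]

theorem compProd_prod_map_fst (μ : Measure E) [SFinite μ] (κ : Kernel E F) (η : Kernel E G)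
    [IsMarkovKernel κ] [IsMarkovKernel η] :
    (μ ⊗ₘ (κ ×ₖ η)).map (fun p => (p.1, p.2.1)) = μ ⊗ₘ κ := by
  have h := Measure.compProd_map (μ := μ) (κ := κ ×ₖ η) (measurable_fst (α := F) (β := G))
  rw [← Kernel.fst_eq, Kernel.fst_prod] at h
  exact h.symm

theorem compProd_prod_map_snd (μ : Measure E) [SFinite μ] (κ : Kernel E F) (η : Kernel E G)
    [IsMarkovKernel κ] [IsMarkovKernel η] :
    (μ ⊗ₘ (κ ×ₖ η)).map (fun p => (p.1, p.2.2)) = μ ⊗ₘ η := by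
  have h := Measure.compProd_map (μ := μ) (κ := κ ×ₖ η) (measurable_snd (α := F) (β := G))
  rw [← Kernel.snd_eq, Kernel.snd_prod] at h
  exact h.symm

/-- A finite measure that is absolutely continuous with respect to `μ ⊗ₘ κ` disintegrates along a
kernel with densities with respect to `κ`. -/
theorem exists_normalized_density (μ : Measure E) [SigmaFinite μ] (κ : Kernel E F)
    [IsMarkovKernel κ] (ρ : Measure (E × F)) [IsFiniteMeasure ρ] (hρ : ρ ≪ μ ⊗ₘ κ) :
    ∃ k : E × F → ℝ≥0∞, Measurable k ∧ (∀ x, ∫⁻ y, k (x, y) ∂(κ x) = 1) ∧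
      ρ = ρ.fst ⊗ₘ (κ.withDensity fun x y => k (x, y)) := by
  classical
  have : SigmaFinite (μ ⊗ₘ κ) := by
    have h : SigmaFinite ((μ ⊗ₘ κ).map Prod.fst) := by
      change SigmaFinite (μ ⊗ₘ κ).fst
      rwa [Measure.fst_compProd]
    exact SigmaFinite.of_map _ measurable_fst.aemeasurable h
  obtain ⟨g, hg, hgρ⟩ : ∃ g : E × F → ℝ≥0∞, Measurable g ∧ (μ ⊗ₘ κ).withDensity g = ρ :=
    ⟨ρ.rnDeriv (μ ⊗ₘ κ), Measure.measurable_rnDeriv _ _, Measure.withDensity_rnDeriv_eq _ _ hρ⟩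
  set f : E → ℝ≥0∞ := fun x => ∫⁻ y, g (x, y) ∂(κ x) with hf
  have hfm : Measurable f := hg.lintegral_kernel_prod_right'
  have hfst : ρ.fst = μ.withDensity f := by
    ext s hs
    rw [Measure.fst_apply hs, ← hgρ, withDensity_apply _ (measurable_fst hs), withDensity_apply _ hs,
      ← prod_univ, Measure.setLIntegral_compProd hg hs .univ]
    simp [hf]
  have hint : ∫⁻ x, f x ∂μ ≠ ∞ := by
    have := measure_ne_top ρ.fst univ
    rwa [hfst, withDensity_apply _ .univ, Measure.restrict_univ] at this
  set D : Set E := {x | f x ≠ 0 ∧ f x ≠ ∞}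
  have hD : MeasurableSet D :=
    ((hfm (measurableSet_singleton 0)).compl).inter ((hfm (measurableSet_singleton ∞)).compl)
  -- The value `1` off `D` makes the new kernel Markov at every point, not just almost everywhere.
  set k : E × F → ℝ≥0∞ := fun p => if p.1 ∈ D then g p / f p.1 else 1
  have hk : Measurable k := Measurable.ite (measurable_fst hD) (by fun_prop) measurable_const
  have hk1 : ∀ x, ∫⁻ y, k (x, y) ∂(κ x) = 1 := fun x => by
    by_cases hx : x ∈ D
    · simp only [k, hx, if_true, div_eq_mul_inv]
      rw [lintegral_mul_const _ (by fun_prop)]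
      exact ENNReal.mul_inv_cancel hx.1 hx.2
    · simp [k, hx]
  have := isMarkovKernel_withDensity κ hk hk1
  have : SFinite (μ.withDensity f) := by rw [← hfst]; infer_instance
  refine ⟨k, hk, hk1, ?_⟩
  rw [hfst, withDensity_compProd_withDensity μ κ hfm hk, ← hgρ]
  refine withDensity_congr_ae (Measure.ae_compProd_of_ae_ae
    (measurableSet_eq_fun hg (by fun_prop)) ?_)
  filter_upwards [ae_lt_top hfm hint] with x hx
  -- Where the normalising factor vanishes, `g (x, ·)` is zero `κ x`-almost everywhere, so the
  -- default value of `k` is harmless.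
  by_cases h0 : f x = 0
  · have h1 : (fun y => g (x, y)) =ᵐ[κ x] 0 := (lintegral_eq_zero_iff (by fun_prop)).1 h0
    filter_upwards [h1] with y hy
    simpa [h0] using hy
  · refine ae_of_all _ fun y => ?_
    have hxD : x ∈ D := ⟨h0, hx.ne⟩
    simp only [k, hxD, if_true]
    exact (ENNReal.mul_div_cancel h0 hx.ne).symm

end Kernel

/-! ### Conditional independence of entropy minimisers. -/

section Minimal

variable {Ω E F G : Type*} [MeasurableSpace Ω] [MeasurableSpace E] [MeasurableSpace F]
  [MeasurableSpace G]

theorem isProbabilityMeasure_of_map_eq {P R : Measure Ω} [IsProbabilityMeasure P] {T : Ω → F}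
    (hT : Measurable T) (h : R.map T = P.map T) : IsProbabilityMeasure R := by
  refine ⟨?_⟩
  have h1 : R.map T univ = P.map T univ := by rw [h]
  rwa [Measure.map_apply hT .univ, Measure.map_apply hT .univ, preimage_univ, measure_univ (μ := P)] at h1

/-- This keeps the localised competitor admissible: exchanging the measures on an event determined
by `T` does not affect the law of `T`. -/
theorem map_restrict_compl_add_restrict {P P' : Measure Ω} {T : Ω → F} (hT : Measurable T)
    (h : P'.map T = P.map T) {C : Set F} (hC : MeasurableSet C) :
    (P.restrict (T ⁻¹' C)ᶜ + P'.restrict (T ⁻¹' C)).map T = P.map T := by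
  rw [Measure.map_add _ _ hT, map_restrict_preimage_congr hT h hC,
    ← Measure.map_add _ _ hT, add_comm, Measure.restrict_add_restrict_compl (hT hC)]

theorem integrable_and_integral_eq_of_map_eq {P P' : Measure Ω} {T : Ω → F} {f : F → ℝ}
    (hT : Measurable T) (hf : Measurable f) (h : P'.map T = P.map T)
    (hint : Integrable (fun ω => f (T ω)) P) :
    Integrable (fun ω => f (T ω)) P' ∧ ∫ ω, f (T ω) ∂P' = ∫ ω, f (T ω) ∂P := by
  have hfm : ∀ μ : Measure F, AEStronglyMeasurable f μ := fun μ => hf.aestronglyMeasurable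
  constructor
  · have h1 : Integrable f (P.map T) := (integrable_map_measure (hfm _) hT.aemeasurable).2 hint
    rw [← h] at h1
    exact (integrable_map_measure (hfm _) hT.aemeasurable).1 h1
  · rw [← integral_map hT.aemeasurable (hfm _), h, integral_map hT.aemeasurable (hfm _)]

/-- If replacing the density `Z` by `Z'` on `D` does not decrease the relative entropy, then the
corresponding inequality holds for the integrals of the log-densities over `D`. -/
theorem setIntegral_log_le_of_relEntropy_le {Q : Measure Ω} [SigmaFinite Q] {Z Z' : Ω → ℝ≥0∞}
    (hZ : Measurable Z) (hZ' : Measurable Z') {D : Set Ω} (hD : MeasurableSet D)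
    (hint : Integrable (fun ω => Real.log (Z ω).toReal) (Q.withDensity Z))
    (hint' : IntegrableOn (fun ω => Real.log (Z' ω).toReal) D (Q.withDensity Z'))
    (hle : relEntropy (Q.withDensity Z) Q ≤
      relEntropy ((Q.withDensity Z).restrict Dᶜ + (Q.withDensity Z').restrict D) Q) :
    ∫ ω in D, Real.log (Z ω).toReal ∂(Q.withDensity Z)
      ≤ ∫ ω in D, Real.log (Z' ω).toReal ∂(Q.withDensity Z') := by
  classical
  set r : Ω → ℝ≥0∞ := Dᶜ.indicator Z + D.indicator Z'
  have hr : Measurable r := (hZ.indicator hD.compl).add (hZ'.indicator hD)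
  have hR : (Q.withDensity Z).restrict Dᶜ + (Q.withDensity Z').restrict D = Q.withDensity r := by
    rw [withDensity_add_left (hZ.indicator hD.compl), withDensity_indicator hD,
      withDensity_indicator hD.compl, restrict_withDensity hD, restrict_withDensity hD.compl]
  have h1 : (fun ω => Real.log (Z ω).toReal) =ᵐ[(Q.withDensity Z).restrict Dᶜ]
      fun ω => Real.log (r ω).toReal := by
    filter_upwards [ae_restrict_mem hD.compl] with ω hω
    have : ω ∉ D := hω
    simp [r, this]
  have h2 : (fun ω => Real.log (Z' ω).toReal) =ᵐ[(Q.withDensity Z').restrict D]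
      fun ω => Real.log (r ω).toReal := by
    filter_upwards [ae_restrict_mem hD] with ω hω
    simp [r, hω]
  have i1 := (integrable_congr h1).1 (hint.integrableOn (s := Dᶜ))
  have i2 := (integrable_congr h2).1 hint'
  have i3 : Integrable (fun ω => Real.log (r ω).toReal) (Q.withDensity r) := by
    rw [← hR]; exact i1.add_measure i2
  -- The contributions of `Dᶜ` to the two entropies are equal and finite, hence cancel.
  rw [relEntropy_withDensity hZ hint, hR, relEntropy_withDensity hr i3, EReal.coe_le_coe_iff,
    ← hR, integral_add_measure i1 i2, ← integral_congr_ae h1, ← integral_congr_ae h2,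
    ← integral_add_compl hD hint] at hle
  linarith

/-- Let `Y` and `W` be conditionally independent given `X` under `Q`. Then they are
conditionally independent given `X` under every minimiser of the relative entropy with respect
to `Q` among the probability measures with the same laws of `(X, Y)` and `(X, W)`. -/
theorem exists_isCondLaw_of_minimal {Q : Measure Ω} {X : Ω → E} {Y : Ω → F} {W : Ω → G}
    (hX : Measurable X) (hY : Measurable Y) (hW : Measurable W) [SigmaFinite (Q.map X)]
    {K : Kernel E F} {L : Kernel E G} (hK : IsCondLaw Q X Y K) (hL : IsCondLaw Q X W L)
    (hKL : IsCondLaw Q X (fun ω => (Y ω, W ω)) (K ×ₖ L))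
    {P : Measure Ω} [IsProbabilityMeasure P] (hfin : relEntropy P Q < ⊤)
    (hmin : ∀ R : Measure Ω, IsProbabilityMeasure R →
      R.map (fun ω => (X ω, Y ω)) = P.map (fun ω => (X ω, Y ω)) →
      R.map (fun ω => (X ω, W ω)) = P.map (fun ω => (X ω, W ω)) →
      relEntropy P Q ≤ relEntropy R Q) :
    ∃ (K' : Kernel E F) (L' : Kernel E G), IsCondLaw P X Y K' ∧ IsCondLaw P X W L' ∧
      IsCondLaw P X (fun ω => (Y ω, W ω)) (K' ×ₖ L') := by
  obtain ⟨mK, hK⟩ := hK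
  obtain ⟨mL, hL⟩ := hL
  obtain ⟨-, hKL⟩ := hKL
  have : SigmaFinite Q := SigmaFinite.of_map Q hX.aemeasurable inferInstance
  obtain ⟨hac, hllr⟩ := absolutelyContinuous_and_integrable_of_relEntropy_lt_top hfin
  have hXY : Measurable fun ω => (X ω, Y ω) := hX.prodMk hY
  have hXW : Measurable fun ω => (X ω, W ω) := hX.prodMk hW
  have hXYW : Measurable fun ω => (X ω, Y ω, W ω) := hX.prodMk (hY.prodMk hW)
  have pX : IsProbabilityMeasure (P.map X) := Measure.isProbabilityMeasure_map hX.aemeasurable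
  have pXY : IsProbabilityMeasure (P.map fun ω => (X ω, Y ω)) :=
    Measure.isProbabilityMeasure_map hXY.aemeasurable
  have pXW : IsProbabilityMeasure (P.map fun ω => (X ω, W ω)) :=
    Measure.isProbabilityMeasure_map hXW.aemeasurable
  -- The densities of the law of `X` and of the conditional laws of `Y` and `W`.
  obtain ⟨Z, hZ, hPZ, hZint⟩ : ∃ Z : Ω → ℝ≥0∞, Measurable Z ∧ P = Q.withDensity Z ∧
      Integrable (fun ω => Real.log (Z ω).toReal) P :=
    ⟨P.rnDeriv Q, Measure.measurable_rnDeriv _ _, (Measure.withDensity_rnDeriv_eq _ _ hac).symm,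
      hllr⟩
  obtain ⟨h, hh, hhX⟩ : ∃ h : E → ℝ≥0∞, Measurable h ∧ P.map X = (Q.map X).withDensity h :=
    ⟨(P.map X).rnDeriv (Q.map X), Measure.measurable_rnDeriv _ _,
      (Measure.withDensity_rnDeriv_eq _ _ (hac.map hX)).symm⟩
  obtain ⟨k, hk, hk1, hkP⟩ := exists_normalized_density (Q.map X) K
    (P.map fun ω => (X ω, Y ω)) (by rw [← hK]; exact hac.map hXY)
  obtain ⟨l, hl, hl1, hlP⟩ := exists_normalized_density (Q.map X) L
    (P.map fun ω => (X ω, W ω)) (by rw [← hL]; exact hac.map hXW)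
  rw [Measure.fst_map_prodMk hY] at hkP
  rw [Measure.fst_map_prodMk hW] at hlP
  have mK' := isMarkovKernel_withDensity K hk hk1
  have mL' := isMarkovKernel_withDensity L hl hl1
  set K' : Kernel E F := K.withDensity fun x y => k (x, y) with hK'
  set L' : Kernel E G := L.withDensity fun x z => l (x, z) with hL'
  have sX : SFinite ((Q.map X).withDensity h) := by rw [← hhX]; infer_instance
  -- The measure `P'` with the same law of `X` and the product of the conditional laws.
  set kl : E × F × G → ℝ≥0∞ := fun p => k (p.1, p.2.1) * l (p.1, p.2.2) with hkl
  have hklm : Measurable kl := by fun_prop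
  set Z' : Ω → ℝ≥0∞ := fun ω => h (X ω) * kl (X ω, Y ω, W ω) with hZ'
  have hZ'm : Measurable Z' := by fun_prop
  set P' : Measure Ω := Q.withDensity Z' with hP'
  have hP'map : P'.map (fun ω => (X ω, Y ω, W ω)) = P.map X ⊗ₘ (K' ×ₖ L') := by
    have mKL : IsMarkovKernel ((K ×ₖ L).withDensity fun x q => kl (x, q)) := by
      have := prod_withDensity_kernel K L hk hl
      simp only [hkl]
      rw [← this]
      infer_instance
    rw [hP', hZ', map_withDensity_comp Q hXYW (g := fun p => h p.1 * kl p) (by fun_prop), hKL,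
      hK', hL', prod_withDensity_kernel K L hk hl, hhX]
    exact (withDensity_compProd_withDensity (Q.map X) (K ×ₖ L) hh hklm).symm
  have hP'Y : P'.map (fun ω => (X ω, Y ω)) = P.map (fun ω => (X ω, Y ω)) := by
    rw [hkP, ← compProd_prod_map_fst (P.map X) K' L', ← hP'map,
      Measure.map_map (by fun_prop) hXYW]
    rfl
  have hP'W : P'.map (fun ω => (X ω, W ω)) = P.map (fun ω => (X ω, W ω)) := by
    rw [hlP, ← compProd_prod_map_snd (P.map X) K' L', ← hP'map,
      Measure.map_map (by fun_prop) hXYW]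
    rfl
  have pP' : IsProbabilityMeasure P' := isProbabilityMeasure_of_map_eq hXY hP'Y
  suffices hPP' : P = P' by
    refine ⟨K', L', ⟨mK', hkP⟩, ⟨mL', hlP⟩, inferInstance, ?_⟩
    rw [← hP'map, ← hPP']
  -- The joint densities.
  set gY : E × F → ℝ≥0∞ := fun p => h p.1 * k p with hgY
  set gW : E × G → ℝ≥0∞ := fun p => h p.1 * l p with hgW
  have hgYm : Measurable gY := by fun_prop
  have hgWm : Measurable gW := by fun_prop
  have hYg : P.map (fun ω => (X ω, Y ω)) = (Q.map fun ω => (X ω, Y ω)).withDensity gY := by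
    rw [hK, hkP, hhX]; exact withDensity_compProd_withDensity (Q.map X) K hh hk
  have hWg : P.map (fun ω => (X ω, W ω)) = (Q.map fun ω => (X ω, W ω)).withDensity gW := by
    rw [hL, hlP, hhX]; exact withDensity_compProd_withDensity (Q.map X) L hh hl
  -- This is `log Z'` written through laws common to `P` and `P'`; `h` occurs in both `gY` and `gW`,
  -- so its logarithm is subtracted once.
  set φ : Ω → ℝ := fun ω => Real.log (gY (X ω, Y ω)).toReal + Real.log (gW (X ω, W ω)).toReal
    - Real.log (h (X ω)).toReal with hφ
  have hfactor : ∀ ω, gY (X ω, Y ω) ≠ 0 ∧ gY (X ω, Y ω) ≠ ∞ →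
      gW (X ω, W ω) ≠ 0 ∧ gW (X ω, W ω) ≠ ∞ →
      (Z' ω ≠ 0 ∧ Z' ω ≠ ∞) ∧ Real.log (Z' ω).toReal = φ ω := by
    intro ω h1 h2
    -- A product in `(0, ∞)` has both factors in `(0, ∞)`, so each logarithm splits.
    simp only [hgY, hgW, ne_eq, mul_eq_zero, not_or, ENNReal.mul_eq_top, not_and, not_not] at h1 h2
    obtain ⟨⟨a1, a2⟩, a3, a4⟩ := h1
    obtain ⟨⟨-, b2⟩, b3, -⟩ := h2
    have c1 : h (X ω) ≠ 0 ∧ h (X ω) ≠ ∞ := ⟨a1, fun hc => a2 (a4 hc)⟩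
    have c2 : k (X ω, Y ω) ≠ 0 ∧ k (X ω, Y ω) ≠ ∞ := ⟨a2, a3 a1⟩
    have c3 : l (X ω, W ω) ≠ 0 ∧ l (X ω, W ω) ≠ ∞ := ⟨b2, b3 a1⟩
    have c4 : k (X ω, Y ω) * l (X ω, W ω) ≠ 0 ∧ k (X ω, Y ω) * l (X ω, W ω) ≠ ∞ :=
      ⟨mul_ne_zero c2.1 c3.1, ENNReal.mul_ne_top c2.2 c3.2⟩
    refine ⟨⟨mul_ne_zero c1.1 c4.1, ENNReal.mul_ne_top c1.2 c4.2⟩, ?_⟩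
    simp only [hZ', hkl, hφ, hgY, hgW]
    rw [log_toReal_mul c1 c4, log_toReal_mul c2 c3, log_toReal_mul c1 c2, log_toReal_mul c1 c3]
    ring
  have hgood : ∀ᵐ ω ∂P, (Z' ω ≠ 0 ∧ Z' ω ≠ ∞) ∧ Real.log (Z' ω).toReal = φ ω := by
    filter_upwards [ae_comp_ne_zero_ne_top hXY hgYm hYg, ae_comp_ne_zero_ne_top hXW hgWm hWg]
      with ω h1 h2 using hfactor ω h1 h2
  have hgood' : ∀ᵐ ω ∂P', (Z' ω ≠ 0 ∧ Z' ω ≠ ∞) ∧ Real.log (Z' ω).toReal = φ ω := by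
    filter_upwards [ae_comp_ne_zero_ne_top hXY hgYm (hP'Y.trans hYg),
      ae_comp_ne_zero_ne_top hXW hgWm (hP'W.trans hWg)] with ω h1 h2 using hfactor ω h1 h2
  -- Restricting to finite `Q`-mass makes all three terms of `φ` integrable.
  have key : ∀ C : Set E, MeasurableSet C → Q.map X C < ∞ →
      P.restrict (X ⁻¹' C) = P'.restrict (X ⁻¹' C) := by
    intro C hC hCfin
    set D := X ⁻¹' C with hD
    have hDm : MeasurableSet D := hX hC
    have fQ : IsFiniteMeasure (Q.restrict D) := ⟨by
      rwa [Measure.restrict_apply_univ, hD, ← Measure.map_apply hX hC]⟩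
    have hPD : P.restrict D = (Q.restrict D).withDensity Z := by
      rw [hPZ, restrict_withDensity hDm]
    have hP'D : P'.restrict D = (Q.restrict D).withDensity Z' := restrict_withDensity hDm _
    have fP : IsFiniteMeasure ((Q.restrict D).withDensity Z) := by rw [← hPD]; infer_instance
    have fP' : IsFiniteMeasure ((Q.restrict D).withDensity Z') := by rw [← hP'D]; infer_instance
    have hZD : Integrable (fun ω => Real.log (Z ω).toReal) ((Q.restrict D).withDensity Z) := by
      rw [← hPD]; exact hZint.integrableOn
    have hCY : MeasurableSet (Prod.fst ⁻¹' C : Set (E × F)) := measurable_fst hC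
    have hCW : MeasurableSet (Prod.fst ⁻¹' C : Set (E × G)) := measurable_fst hC
    have iX : Integrable (fun ω => Real.log (h (X ω)).toReal) (P.restrict D) := by
      rw [hPD]
      refine integrable_log_density_map hZ hZD hX hh ?_
      rw [← hPD]; exact map_restrict_preimage_withDensity hX hhX hC
    have iY : Integrable (fun ω => Real.log (gY (X ω, Y ω)).toReal) (P.restrict D) := by
      rw [hPD]
      refine integrable_log_density_map hZ hZD hXY hgYm ?_
      rw [← hPD]; exact map_restrict_preimage_withDensity hXY hYg hCY
    have iW : Integrable (fun ω => Real.log (gW (X ω, W ω)).toReal) (P.restrict D) := by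
      rw [hPD]
      refine integrable_log_density_map hZ hZD hXW hgWm ?_
      rw [← hPD]; exact map_restrict_preimage_withDensity hXW hWg hCW
    have eY : (P'.restrict D).map (fun ω => (X ω, Y ω)) = (P.restrict D).map fun ω => (X ω, Y ω) :=
      map_restrict_preimage_congr hXY hP'Y hCY
    have eW : (P'.restrict D).map (fun ω => (X ω, W ω)) = (P.restrict D).map fun ω => (X ω, W ω) :=
      map_restrict_preimage_congr hXW hP'W hCW
    obtain ⟨iX', jX⟩ := integrable_and_integral_eq_of_map_eq (f := fun p => Real.log (h p.1).toReal)
      hXY (by fun_prop) eY iX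
    obtain ⟨iY', jY⟩ := integrable_and_integral_eq_of_map_eq (f := fun p => Real.log (gY p).toReal)
      hXY (by fun_prop) eY iY
    obtain ⟨iW', jW⟩ := integrable_and_integral_eq_of_map_eq (f := fun p => Real.log (gW p).toReal)
      hXW (by fun_prop) eW iW
    have iφ : Integrable φ (P.restrict D) := (iY.add iW).sub iX
    have iφ' : Integrable φ (P'.restrict D) := (iY'.add iW').sub iX'
    have jφ : ∫ ω, φ ω ∂(P'.restrict D) = ∫ ω, φ ω ∂(P.restrict D) := by
      calc _ = _ := integral_sub (iY'.add iW') iX'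
        _ = _ := congrArg (· - _) (integral_add iY' iW')
        _ = _ := by rw [jX, jY, jW]
        _ = _ := congrArg (· - _) (integral_add iY iW).symm
        _ = _ := (integral_sub (iY.add iW) iX).symm
    have eφ : (fun ω => Real.log (Z' ω).toReal) =ᵐ[P.restrict D] φ :=
      ae_restrict_of_ae (hgood.mono fun ω hω => hω.2)
    have eφ' : (fun ω => Real.log (Z' ω).toReal) =ᵐ[P'.restrict D] φ :=
      ae_restrict_of_ae (hgood'.mono fun ω hω => hω.2)
    have hRY := map_restrict_compl_add_restrict hXY hP'Y hCY
    have hRW := map_restrict_compl_add_restrict hXW hP'W hCW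
    have hle : ∫ ω in D, Real.log (Z ω).toReal ∂P ≤ ∫ ω in D, Real.log (Z' ω).toReal ∂P' := by
      -- Since `D` depends only on `X`, it is an event of both `(X, Y)` and `(X, W)`, whose laws are
      -- therefore unchanged.
      have hR := hmin (P.restrict Dᶜ + P'.restrict D)
        (isProbabilityMeasure_of_map_eq hXY hRY) hRY hRW
      rw [hPZ] at hR hZint ⊢
      exact setIntegral_log_le_of_relEntropy_le hZ hZ'm hDm hZint
        ((integrable_congr eφ').2 iφ') hR
    -- Moving `∫ log Z'` from `P'` to `P` turns minimality into the reverse of Gibbs' inequality on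
    -- `D`, forcing equality.
    rw [integral_congr_ae eφ', jφ, ← integral_congr_ae eφ, hPD] at hle
    rw [hPD, hP'D]
    refine withDensity_eq_of_integral_log_le hZ hZ'm ?_ ?_ hZD ?_ hle
    · have h1 : (P.restrict D).map (fun ω => (X ω, Y ω)) univ
          = (P'.restrict D).map (fun ω => (X ω, Y ω)) univ := by rw [eY]
      rwa [Measure.map_apply hXY .univ, Measure.map_apply hXY .univ, preimage_univ, hPD,
        hP'D] at h1
    · rw [← hPD]; exact ae_restrict_of_ae (hgood.mono fun ω hω => hω.1)
    · rw [← hPD]; exact (integrable_congr eφ).2 iφ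
  refine Measure.ext_of_iUnion_eq_univ (s := fun n => X ⁻¹' spanningSets (Q.map X) n) ?_ fun n =>
    key _ (measurableSet_spanningSets _ n) (measure_spanningSets_lt_top _ n)
  rw [← preimage_iUnion, iUnion_spanningSets, preimage_univ]

end Minimal

/-! ### Path measures on the tree and the conclusion. -/

namespace LengthTree

variable {V : Type*} {T : LengthTree V} {d : ℕ}

theorem measurable_restrict (A : Set T.Point) :
    Measurable fun ω : T.PathSpace d => ω.restrict A :=
  (ContinuousMap.continuous_restrict A).measurable

theorem measurable_eval {A : Type*} [TopologicalSpace A] (p : A) :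
    Measurable fun ω : C(A, EuclideanSpace ℝ (Fin d)) => ω p :=
  (continuous_eval_const p).measurable

theorem sigmaFinite_of_marginal {Q : Measure (T.PathSpace d)} {q : T.Point}
    [h : SigmaFinite (marginal Q q)] : SigmaFinite Q :=
  SigmaFinite.of_map Q (measurable_eval q).aemeasurable h

/-- If the conditional law given `X_p` of the restriction to `A ∋ q` exists and `X_q` has a
σ-finite law, then so has `X_p`. -/
theorem sigmaFinite_marginal_of_isCondLaw {Q : Measure (T.PathSpace d)} {p q : T.Point}
    {A : Set T.Point} (hq : q ∈ A) [hσ : SigmaFinite (marginal Q q)]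
    {K : Kernel (EuclideanSpace ℝ (Fin d)) C(A, EuclideanSpace ℝ (Fin d))}
    (hK : IsCondLaw Q (fun ω => ω p) (fun ω => ω.restrict A) K) :
    SigmaFinite (marginal Q p) := by
  have : SigmaFinite Q := sigmaFinite_of_marginal (q := q)
  obtain ⟨_, hK⟩ := hK
  have hm : Measurable fun x : EuclideanSpace ℝ (Fin d) × C(A, EuclideanSpace ℝ (Fin d)) =>
      x.2 ⟨q, hq⟩ := (measurable_eval _).comp measurable_snd
  have h : SigmaFinite (Q.map fun ω => (ω p, ω.restrict A)) := by
    -- The pair determines `X_q`, so a σ-finite law of `X_q` pulls back to the law of the pair.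
    refine SigmaFinite.of_map _ hm.aemeasurable ?_
    rw [Measure.map_map hm ((measurable_eval p).prodMk (measurable_restrict A))]
    exact hσ
  rw [hK] at h
  exact sigmaFinite_of_compProd (Q.map fun ω => ω p) K

/-- Reduces each vertex constraint to the law of one part of the split. -/
theorem marginal_congr_of_restrict {P R : Measure (T.PathSpace d)} {p q : T.Point}
    {A : Set T.Point} (hq : q ∈ A)
    (h : R.map (fun ω => (ω p, ω.restrict A)) = P.map fun ω => (ω p, ω.restrict A)) :
    marginal R q = marginal P q := by
  have hm : Measurable fun x : EuclideanSpace ℝ (Fin d) × C(A, EuclideanSpace ℝ (Fin d)) =>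
      x.2 ⟨q, hq⟩ := (measurable_eval _).comp measurable_snd
  have hr := (measurable_eval (d := d) p).prodMk (measurable_restrict A)
  have h1 := congrArg (Measure.map fun x => x.2 ⟨q, hq⟩) h
  rwa [Measure.map_map hm hr, Measure.map_map hm hr] at h1

end LengthTree

theorem mainTheorem9 {V : Type*} [Finite V] (T : LengthTree V) (d : ℕ)
    (Q : Measure (T.PathSpace d)) (hQ : LengthTree.IsMarkov Q)
    (S : Set V) (μ : S → Measure (EuclideanSpace ℝ (Fin d)))
    (hμ : ∀ i, IsProbabilityMeasure (μ i))
    (P : Measure (T.PathSpace d)) (hP : LengthTree.IsTreeSBSolution Q S μ P) :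
    LengthTree.IsMarkov P := by
  obtain ⟨⟨hprob, hmarg⟩, hfin, hmin⟩ := hP
  obtain ⟨⟨q, hq⟩, hcond⟩ := hQ
  refine ⟨⟨q, ?_⟩, fun p A B hsplit => ?_⟩
  · have : IsProbabilityMeasure (LengthTree.marginal P q) :=
      Measure.isProbabilityMeasure_map (LengthTree.measurable_eval q).aemeasurable
    infer_instance
  obtain ⟨K, L, hK, hL, hKL⟩ := hcond p A B hsplit
  have hmem : ∀ x, x ∈ A ∨ x ∈ B := fun x => by
    rw [← mem_union, hsplit.union_eq]; exact mem_univ x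
  have : SigmaFinite (Q.map fun ω => ω p) := by
    rcases hmem q with hqA | hqB
    · exact LengthTree.sigmaFinite_marginal_of_isCondLaw hqA hK
    · exact LengthTree.sigmaFinite_marginal_of_isCondLaw hqB hL
  refine exists_isCondLaw_of_minimal (LengthTree.measurable_eval p)
    (LengthTree.measurable_restrict A) (LengthTree.measurable_restrict B) hK hL hKL hfin
    -- Every observed vertex lies in `A` or `B`, so a measure with the right laws on both parts is
    -- admissible.
    fun R hR hRA hRB => hmin R ⟨hR, fun i => ?_⟩
  rw [← hmarg i]
  rcases hmem (T.vertex i) with hi | hi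
  · exact LengthTree.marginal_congr_of_restrict hi hRA
  · exact LengthTree.marginal_congr_of_restrict hi hRB
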